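/- All graphs are finite and simple and have at least one vertex. A search tree on a connected graph $G$ is a rooted tree with vertex set $V(G)$ defined recursively: its root is a vertex $r\in V(G)$, and the children of $r$ are the roots of search trees on the connected components of $G-r$ (one for each component). Let $T$ be a search tree on $G$ and let $v$ be a child of $u$ in $T$. The $uv$-rotation of $T$ is the search tree $T'$ on $G$ in which $v$ takes the place of $u$ (as a child of the parent of $u$ in $T$, or as the root if $u$ was the root), $u$ is a child of $v$, every subtree of $u$ in $T$ other than the one rooted at $v$ stays a subtree of $u$, and every subtree $S$ of $v$ in $T$ becomes a subtree of $u$ if $u$ is adjacent in $G$ to a vertex of $S$, and stays a subtree of $v$ otherwise; all other parent–child relations are unchanged. The rotation graph $\mathcal{R}(G)$ has the search trees on $G$ as vertices, two of them being adjacent if and only if they differ by one rotation. A vertex of $G$ is universal if it is adjacent to all other vertices of $G$. For a clique $K\subseteq V(G)$, $G_K$ denotes the graph obtained from $G$ by adding one new vertex $x\notin V(G)$ whose neighbourhood is $K$. Finally, $\chi$ denotes the chromatic number. **Proposition.** Let $G$ be a connected graph that is not complete, and let $K\subseteq V(G)$ be a nonempty set of universal vertices of $G$ (so $K$ is a clique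 and the new vertex of $G_K$ is simplicial). Then $$\chi(\mathcal{R}(G_K))=\chi(\mathcal{R}(G)).$$ In particular, if $v$ is a universal vertex of $G$, so that $G_{\{v\}}$ is obtained by adding a pendant vertex at $v$, then $\chi(\mathcal{R}(G_{\{v\}}))=\chi(\mathcal{R}(G))$. -/

import Mathlib

/-- A rooted tree with vertex set `V` (without a fixed order of the children), given by its root and its parent function: the root is the
only vertex without a parent, and every vertex is joined to the root by its chain of parents. -/
@[ext]
structure RootedTreeOn (V : Type*) where
  root : V
  parent : V → Option V
  parent_eq_none_iff : ∀ v, parent v = none ↔ v = root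
  reaches_root : ∀ v, Relation.ReflTransGen (fun a b => parent a = some b) v root

namespace RootedTreeOn

variable {V : Type*}

/-- The vertex set of the subtree `T|v`: all `w` such that `v` lies on the path from `w` to the
root (so `v` itself belongs to it). -/
def subtree (T : RootedTreeOn V) (v : V) : Set V :=
  {w | Relation.ReflTransGen (fun a b => T.parent a = some b) w v}

/-- `T.IsSearchTreeOn G S r`: the subtree of `T` rooted at `r` is a search tree on the induced
subgraph `G[S]`. That is, `r ∈ S`, the children of `r` in `T` are exactly one chosen vertex `c C` for
each connected component `C` of `G[S] - r`, and the subtree of `T` rooted at `c C` is a search tree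
on `C`. -/
inductive IsSearchTreeOn (T : RootedTreeOn V) (G : SimpleGraph V) : Set V → V → Prop
  | node (S : Set V) (r : V) (mem : r ∈ S)
      (c : (G.induce (S \ {r})).ConnectedComponent → V)
      (children : ∀ v, T.parent v = some r ↔ ∃ C, c C = v)
      (components : ∀ C, IsSearchTreeOn T G (Subtype.val '' C.supp) (c C)) :
      IsSearchTreeOn T G S r

/-- `T` is a search tree on the (connected) graph `G`. -/
def IsSearchTree (T : RootedTreeOn V) (G : SimpleGraph V) : Prop :=
  T.IsSearchTreeOn G Set.univ T.root

/-- `T'` is obtained from the search tree `T` on `G` by the `uv`-rotation, where `v` is a child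
of `u` in `T`. -/
structure IsRotation (G : SimpleGraph V) (T : RootedTreeOn V) (u v : V) (T' : RootedTreeOn V) :
    Prop where
  /-- `v` is a child of `u` in `T`. -/
  child : T.parent v = some u
  /-- In `T'`, `u` is a child of `v`. -/
  parent_lower : T'.parent u = some v
  /-- In `T'`, `v` is a child of the parent of `u` in `T` (and is the root if `u` was the root). -/
  parent_upper : T'.parent v = T.parent u
  /-- A subtree of `v` in `T` with a vertex adjacent to `u` in `G` becomes a subtree of `u`. -/
  parent_moved : ∀ w, T.parent w = some v → (∃ s ∈ T.subtree w, G.Adj u s) →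
    T'.parent w = some u
  /-- Every other subtree of `v` in `T` remains a subtree of `v`. -/
  parent_kept : ∀ w, T.parent w = some v → (¬ ∃ s ∈ T.subtree w, G.Adj u s) →
    T'.parent w = some v
  /-- Every other vertex, in particular every child of `u` in `T` other than `v`, keeps its
  parent. -/
  parent_other : ∀ w, w ≠ u → w ≠ v → T.parent w ≠ some v → T'.parent w = T.parent w

end RootedTreeOn

namespace SimpleGraph

variable {V : Type*}

/-- The rotation graph `R(G)` of a connected graph `G`: its vertices are the search trees on `G`,
and two different ones are adjacent if one of them is obtained from the other by one rotation. -/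
def rotationGraph (G : SimpleGraph V) :
    SimpleGraph {T : RootedTreeOn V // T.IsSearchTree G} :=
  SimpleGraph.fromRel fun T T' => ∃ u v, RootedTreeOn.IsRotation G T.1 u v T'.1

/-- The adjacency relation of `G_K`, where `none` is the new vertex. -/
def addVertexAdj (G : SimpleGraph V) (K : Set V) : Option V → Option V → Prop
  | some a, some b => G.Adj a b
  | some a, none => a ∈ K
  | none, some b => b ∈ K
  | none, none => False

/-- The graph `G_K` obtained from `G` by adding a new vertex `none` with neighbourhood `K`
(a simplicial vertex when `K` is a clique). -/
def addVertex (G : SimpleGraph V) (K : Set V) : SimpleGraph (Option V) where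
  Adj := addVertexAdj G K
  symm := ⟨by
    rintro (_ | a) (_ | b) h
    · exact h
    · exact h
    · exact h
    · exact G.adj_symm h⟩
  loopless := ⟨by
    rintro (_ | a) h
    · exact h
    · exact G.loopless.irrefl a h⟩

end SimpleGraph

namespace SimpleGraph

variable {V : Type*}

theorem Connected.exists_adj_boundary {G : SimpleGraph V} {S A : Set V}
    (h : (G.induce S).Connected) {a b : V} (haS : a ∈ S) (hbS : b ∈ S) (ha : a ∈ A) (hb : b ∉ A) :
    ∃ s t, s ∈ S ∧ t ∈ S ∧ s ∈ A ∧ t ∉ A ∧ G.Adj s t := by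
  obtain ⟨p⟩ := h.preconnected ⟨a, haS⟩ ⟨b, hbS⟩
  obtain ⟨d, -, hd, hd'⟩ := p.exists_boundary_dart (Subtype.val ⁻¹' A) ha hb
  exact ⟨d.fst, d.snd, d.fst.2, d.snd.2, hd, hd', d.adj⟩

theorem connected_induce_of_forall_adj {G : SimpleGraph V} {S : Set V} {u : V} (hu : u ∈ S)
    (h : ∀ w ∈ S, u ≠ w → G.Adj u w) : (G.induce S).Connected :=
  Connected.of_isUniversal (v := ⟨u, hu⟩) fun w hw => h w w.2 fun e => hw (Subtype.ext e)

theorem connected_induce_image_supp (G : SimpleGraph V) {S : Set V}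
    (C : (G.induce S).ConnectedComponent) : (G.induce (Subtype.val '' C.supp)).Connected := by
  let f : (G.induce S).induce C.supp →g G.induce (Subtype.val '' C.supp) :=
    ⟨fun x => ⟨x.1.1, x.1, x.2, rfl⟩, fun h => h⟩
  refine (ConnectedComponent.maximal_connected_induce_supp C).1.map f ?_
  rintro ⟨_, y, hy, rfl⟩
  exact ⟨⟨y, hy⟩, rfl⟩

end SimpleGraph

namespace RootedTreeOn

variable {V : Type*} (T : RootedTreeOn V) {T' : RootedTreeOn V}

theorem mem_subtree_self (v : V) : v ∈ T.subtree v := Relation.ReflTransGen.refl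

variable {T}

theorem mem_subtree_trans {a b c : V} (h : a ∈ T.subtree b) (h' : b ∈ T.subtree c) :
    a ∈ T.subtree c :=
  Relation.ReflTransGen.trans h h'

theorem mem_subtree_of_parent {a b : V} (h : T.parent a = some b) : a ∈ T.subtree b :=
  Relation.ReflTransGen.single h

theorem mem_subtree_root (a : V) : a ∈ T.subtree T.root := T.reaches_root a

theorem mem_subtree_total {a b c : V} (h : a ∈ T.subtree b) (h' : a ∈ T.subtree c) :
    b ∈ T.subtree c ∨ c ∈ T.subtree b :=
  Relation.ReflTransGen.total_of_right_unique
    (fun _ _ _ h₁ h₂ => Option.some_injective _ (h₁.symm.trans h₂)) h h'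

theorem mem_subtree_iff_parent {a z : V} :
    a ∈ T.subtree z ↔ a = z ∨ ∃ p, T.parent a = some p ∧ p ∈ T.subtree z :=
  Relation.ReflTransGen.cases_head_iff

theorem mem_subtree_iff_child {a z : V} :
    a ∈ T.subtree z ↔ a = z ∨ ∃ c, T.parent c = some z ∧ a ∈ T.subtree c := by
  refine Relation.ReflTransGen.cases_tail_iff .. |>.trans ?_
  constructor
  · rintro (h | ⟨c, h, h'⟩)
    · exact Or.inl h.symm
    · exact Or.inr ⟨c, h', h⟩
  · rintro (h | ⟨c, h, h'⟩)
    · exact Or.inl h.symm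
    · exact Or.inr ⟨c, h', h⟩

theorem not_mem_subtree_of_parent {a p : V} (h : T.parent a = some p) : p ∉ T.subtree a := by
  intro hp
  have key : ∀ c, a ∈ T.subtree c → ∃ q, T.parent c = some q ∧ q ∈ T.subtree c := by
    intro c hc
    induction hc with
    | refl => exact ⟨p, h, hp⟩
    | @tail b c _ hbc ih =>
      obtain ⟨q, hq, hqb⟩ := ih
      obtain rfl : q = c := Option.some_injective _ (hq.symm.trans hbc)
      rcases mem_subtree_iff_parent.1 hqb with e | ⟨d, hd, hdb⟩
      · subst e
        exact ⟨q, hbc, hqb⟩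
      · exact ⟨d, hd, mem_subtree_trans hdb (mem_subtree_of_parent hbc)⟩
  obtain ⟨q, hq, -⟩ := key _ (mem_subtree_root a)
  rw [(T.parent_eq_none_iff _).2 rfl] at hq
  cases hq

theorem mem_subtree_antisymm {a b : V} (h : a ∈ T.subtree b) (h' : b ∈ T.subtree a) : a = b := by
  rcases mem_subtree_iff_parent.1 h with e | ⟨p, hp, hpb⟩
  · exact e
  · exact (not_mem_subtree_of_parent hp (mem_subtree_trans hpb h')).elim

theorem mem_subtree_of_parent_of_ne {a p z : V} (h : T.parent a = some p) (hz : a ∈ T.subtree z)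
    (hne : a ≠ z) : p ∈ T.subtree z := by
  rcases mem_subtree_iff_parent.1 hz with e | ⟨q, hq, hqz⟩
  · exact (hne e).elim
  · obtain rfl : q = p := Option.some_injective _ (hq.symm.trans h)
    exact hqz

theorem parent_eq_some_iff {a p : V} : T.parent a = some p ↔
    a ∈ T.subtree p ∧ a ≠ p ∧ ∀ z, a ∈ T.subtree z → a ≠ z → p ∈ T.subtree z := by
  refine ⟨fun h => ⟨mem_subtree_of_parent h, ?_, fun z => mem_subtree_of_parent_of_ne h⟩, ?_⟩
  · rintro rfl
    exact not_mem_subtree_of_parent h (T.mem_subtree_self a)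
  · rintro ⟨h, hne, hmin⟩
    rcases mem_subtree_iff_parent.1 h with e | ⟨q, hq, hqp⟩
    · exact (hne e).elim
    · have hqa : a ≠ q := by
        rintro rfl
        exact not_mem_subtree_of_parent hq (T.mem_subtree_self a)
      rw [hq, mem_subtree_antisymm hqp (hmin q (mem_subtree_of_parent hq) hqa)]

theorem parent_ne {a p : V} (h : T.parent a = some p) : a ≠ p := (parent_eq_some_iff.1 h).2.1

theorem parent_eq_none_iff_subtree {a : V} : T.parent a = none ↔ ∀ b, b ∈ T.subtree a := by
  rw [T.parent_eq_none_iff]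
  constructor
  · rintro rfl b
    exact mem_subtree_root b
  · intro h
    exact mem_subtree_antisymm (mem_subtree_root a) (h _)

theorem eq_of_subtree (h : ∀ v, T.subtree v = T'.subtree v) : T = T' := by
  ext v w
  · rw [mem_subtree_antisymm (T := T') (mem_subtree_root T.root)
      (by rw [← h]; exact mem_subtree_root _)]
  · simp only [parent_eq_some_iff, h]

/-- A finite poset in which the elements above any given one form a chain and in which some element
is comparable with all others is the ancestor order of a rooted tree. -/
theorem exists_of_order [Finite V] (le : V → V → Prop) (refl : ∀ a, le a a)
    (trans : ∀ a b c, le a b → le b c → le a c) (antisymm : ∀ a b, le a b → le b a → a = b)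
    (chain : ∀ a b c, le a b → le a c → le b c ∨ le c b)
    (u : V) (hu : ∀ a, le u a ∨ le a u) :
    ∃ T : RootedTreeOn V, ∀ a b, a ∈ T.subtree b ↔ le a b := by
  classical
  let _ : PartialOrder V :=
    { le := le, le_refl := refl, le_trans := trans, le_antisymm := antisymm }
  change ∀ a b c : V, a ≤ b → a ≤ c → b ≤ c ∨ c ≤ b at chain
  change ∀ a : V, u ≤ a ∨ a ≤ u at hu
  change ∃ T : RootedTreeOn V, ∀ a b, a ∈ T.subtree b ↔ a ≤ b
  obtain ⟨r, hur, hr⟩ := (Set.toFinite (Set.Ici u)).exists_maximal ⟨u, Set.mem_Ici.2 le_rfl⟩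
  have htop : ∀ a, a ≤ r := by
    intro a
    rcases hu a with h | h
    · rcases chain u a r h hur with h' | h'
      · exact h'
      · exact hr h h'
    · exact h.trans hur
  have hpar : ∀ a, a ≠ r → ∃ p, a < p ∧ ∀ z, a < z → p ≤ z := by
    intro a ha
    obtain ⟨p, hap, hp⟩ := (Set.toFinite (Set.Ioi a)).exists_minimal ⟨r, (htop a).lt_of_ne ha⟩
    refine ⟨p, hap, fun z hz => ?_⟩
    rcases chain a p z hap.le hz.le with h | h
    · exact h
    · exact hp hz h
  choose! p hp hpmin using hpar
  let par : V → Option V := fun a => if a = r then none else some (p a)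
  have hsub : ∀ b a, a ≤ b → Relation.ReflTransGen (fun a b => par a = some b) a b := by
    intro b a
    induction a using WellFoundedGT.induction with
    | ind a ih =>
      intro hab
      by_cases e : a = b
      · subst e
        exact .refl
      · have har : a ≠ r := by
          rintro rfl
          exact e (le_antisymm hab (htop b))
        exact .head (b := p a) (by simp [par, har])
          (ih _ (hp a har) (hpmin a har b (hab.lt_of_ne e)))
  refine ⟨⟨r, par, fun v => by simp [par], fun v => hsub r v (htop v)⟩, fun a b => ⟨?_, hsub b a⟩⟩
  intro h
  induction h using Relation.ReflTransGen.head_induction_on with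
  | refl => exact le_rfl
  | @head a c hac _ ih =>
    simp only [par] at hac
    split_ifs at hac with har
    cases hac
    exact (hp a har).le.trans ih

section SearchTree

variable {G : SimpleGraph V}

theorem IsSearchTreeOn.subtree_spec {S : Set V} {r : V} (h : T.IsSearchTreeOn G S r) :
    T.subtree r = S ∧
    (∀ a ∈ S, ∀ b ∈ S, G.Adj a b → a ∈ T.subtree b ∨ b ∈ T.subtree a) ∧
    ((G.induce S).Connected → ∀ v ∈ S, (G.induce (T.subtree v)).Connected) := by
  induction h with
  | node S r mem c children components ih =>
    have hsub : T.subtree r = S := by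
      ext a
      rw [mem_subtree_iff_child]
      constructor
      · rintro (rfl | ⟨v, hv, hav⟩)
        · exact mem
        · obtain ⟨C, rfl⟩ := (children v).1 hv
          rw [(ih C).1] at hav
          obtain ⟨x, -, rfl⟩ := hav
          exact x.2.1
      · intro ha
        by_cases har : a = r
        · exact Or.inl har
        · let C := (G.induce (S \ {r})).connectedComponentMk ⟨a, ha, har⟩
          refine Or.inr ⟨c C, (children _).2 ⟨C, rfl⟩, ?_⟩
          rw [(ih C).1]
          exact ⟨_, rfl, rfl⟩
    refine ⟨hsub, ?_, ?_⟩
    · intro a ha b hb hab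
      by_cases har : a = r
      · subst har
        exact Or.inr (hsub ▸ hb)
      by_cases hbr : b = r
      · subst hbr
        exact Or.inl (hsub ▸ ha)
      let C := (G.induce (S \ {r})).connectedComponentMk ⟨a, ha, har⟩
      refine (ih C).2.1 a ⟨_, rfl, rfl⟩ b ⟨⟨b, hb, hbr⟩, ?_, rfl⟩ hab
      exact SimpleGraph.ConnectedComponent.sound (SimpleGraph.Adj.reachable hab.symm)
    · intro hS v hv
      by_cases hvr : v = r
      · subst hvr
        rwa [hsub]
      · exact (ih ((G.induce (S \ {r})).connectedComponentMk ⟨v, hv, hvr⟩)).2.2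
          (SimpleGraph.connected_induce_image_supp _ _) v ⟨_, rfl, rfl⟩

theorem isSearchTreeOn_subtree [Finite V]
    (hadj : ∀ a b, G.Adj a b → a ∈ T.subtree b ∨ b ∈ T.subtree a)
    (hconn : ∀ v, (G.induce (T.subtree v)).Connected) (r : V) :
    T.IsSearchTreeOn G (T.subtree r) r := by
  induction hn : (T.subtree r).ncard using Nat.strong_induction_on generalizing r with
  | _ n ih =>
    subst hn
    have hlt : ∀ v, T.parent v = some r → (T.subtree v).ncard < (T.subtree r).ncard := by
      intro v hv
      refine Set.ncard_lt_ncard ⟨fun a ha => mem_subtree_trans ha (mem_subtree_of_parent hv), ?_⟩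
      exact fun h => not_mem_subtree_of_parent hv (h (T.mem_subtree_self r))
    have hss : ∀ v, T.parent v = some r → ∀ a ∈ T.subtree v, a ∈ T.subtree r \ {r} := by
      intro v hv a ha
      refine ⟨mem_subtree_trans ha (mem_subtree_of_parent hv), ?_⟩
      rintro rfl
      exact not_mem_subtree_of_parent hv ha
    have hcomp : ∀ (v : V) (hv : T.parent v = some r) (x : ↥(T.subtree r \ {r})),
        x.1 ∈ T.subtree v → Subtype.val ''
          ((G.induce (T.subtree r \ {r})).connectedComponentMk x).supp = T.subtree v := by
      intro v hv x hx
      ext a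
      constructor
      · rintro ⟨y, hy, rfl⟩
        by_contra hyv
        obtain ⟨p⟩ := SimpleGraph.ConnectedComponent.exact (Eq.symm hy)
        obtain ⟨d, -, hd, hd'⟩ := p.exists_boundary_dart (Subtype.val ⁻¹' T.subtree v) hx hyv
        rcases hadj d.fst d.snd d.adj with h | h
        · rcases mem_subtree_total hd h with h' | h'
          · by_cases e : v = d.snd.1
            · exact hd' (e ▸ T.mem_subtree_self v)
            · exact d.snd.2.2 (mem_subtree_antisymm d.snd.2.1
                (mem_subtree_of_parent_of_ne hv h' e))
          · exact hd' h'
        · exact hd' (mem_subtree_trans h hd)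
      · intro ha
        refine ⟨⟨a, hss v hv a ha⟩, ?_, rfl⟩
        refine SimpleGraph.ConnectedComponent.sound ?_
        exact ((hconn v).preconnected ⟨a, ha⟩ ⟨x.1, hx⟩).map
          (G.induceHomOfLE (hss v hv)).toHom
    have hex : ∀ C : (G.induce (T.subtree r \ {r})).ConnectedComponent,
        ∃ v, T.parent v = some r ∧ Subtype.val '' C.supp = T.subtree v := by
      intro C
      induction C using SimpleGraph.ConnectedComponent.ind with
      | h x =>
        rcases mem_subtree_iff_child.1 x.2.1 with e | ⟨v, hv, hxv⟩
        · exact (x.2.2 e).elim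
        · exact ⟨v, hv, hcomp v hv x hxv⟩
    choose c hc hcs using hex
    refine .node _ r (T.mem_subtree_self r) c (fun v => ⟨fun hv => ?_, ?_⟩) fun C => ?_
    · let x : ↥(T.subtree r \ {r}) := ⟨v, hss v hv v (T.mem_subtree_self v)⟩
      refine ⟨(G.induce _).connectedComponentMk x, ?_⟩
      have h := (hcs ((G.induce _).connectedComponentMk x)).symm.trans
        (hcomp v hv x (T.mem_subtree_self v))
      exact mem_subtree_antisymm (h ▸ T.mem_subtree_self _)
        (h.symm ▸ T.mem_subtree_self _)
    · rintro ⟨C, rfl⟩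
      exact hc C
    · rw [hcs]
      exact ih _ (hlt _ (hc C)) _ rfl

theorem isSearchTree_iff [Finite V] (hG : G.Connected) : T.IsSearchTree G ↔
    (∀ a b, G.Adj a b → a ∈ T.subtree b ∨ b ∈ T.subtree a) ∧
      ∀ v, (G.induce (T.subtree v)).Connected := by
  have huniv : T.subtree T.root = Set.univ := Set.eq_univ_of_forall mem_subtree_root
  constructor
  · intro h
    obtain ⟨-, h₁, h₂⟩ := IsSearchTreeOn.subtree_spec h
    refine ⟨fun a b => h₁ a trivial b trivial, fun v => h₂ ?_ v trivial⟩
    exact (G.induceUnivIso.connected_iff).2 hG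
  · rintro ⟨h₁, h₂⟩
    have := isSearchTreeOn_subtree h₁ h₂ T.root
    rwa [huniv] at this

theorem IsRotation.subtree_spec {u v : V} (h : T.IsRotation G u v T') :
    T'.subtree v = T.subtree u ∧ ∀ w, w ≠ u → w ≠ v → T'.subtree w = T.subtree w := by
  have hpar : ∀ a, a = u ∨ a = v ∨
      (T.parent a = some v ∧ (T'.parent a = some u ∨ T'.parent a = some v)) ∨
      T'.parent a = T.parent a := by
    intro a
    by_cases hu : a = u
    · exact Or.inl hu
    by_cases hv : a = v
    · exact Or.inr (Or.inl hv)
    by_cases hp : T.parent a = some v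
    · by_cases hs : ∃ s ∈ T.subtree a, G.Adj u s
      · exact Or.inr (Or.inr (Or.inl ⟨hp, Or.inl (h.parent_moved a hp hs)⟩))
      · exact Or.inr (Or.inr (Or.inl ⟨hp, Or.inr (h.parent_kept a hp hs)⟩))
    · exact Or.inr (Or.inr (Or.inr (h.parent_other a hu hv hp)))
  have hvu := mem_subtree_of_parent h.child
  have huv := mem_subtree_of_parent h.parent_lower
  refine ⟨?_, fun w hwu hwv => ?_⟩
  · ext a
    constructor
    · intro ha
      induction ha using Relation.ReflTransGen.head_induction_on with
      | refl => exact hvu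
      | @head a p hap _ ih =>
        rcases hpar a with rfl | rfl | ⟨hp, -⟩ | hp
        · exact T.mem_subtree_self a
        · exact hvu
        · exact mem_subtree_trans (mem_subtree_of_parent hp) hvu
        · exact mem_subtree_trans (mem_subtree_of_parent (hp ▸ hap)) ih
    · intro ha
      induction ha using Relation.ReflTransGen.head_induction_on with
      | refl => exact huv
      | @head a p hap _ ih =>
        rcases hpar a with rfl | rfl | ⟨-, hp | hp⟩ | hp
        · exact huv
        · exact T'.mem_subtree_self a
        · exact mem_subtree_trans (mem_subtree_of_parent hp) huv
        · exact mem_subtree_of_parent hp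
        · exact mem_subtree_trans (mem_subtree_of_parent (hp ▸ hap)) ih
  · ext a
    constructor
    · intro ha
      induction ha using Relation.ReflTransGen.head_induction_on with
      | refl => exact T.mem_subtree_self w
      | @head a p hap _ ih =>
        rcases hpar a with rfl | rfl | ⟨hp, hp' | hp'⟩ | hp
        · obtain rfl : v = p := Option.some_injective _ (h.parent_lower.symm.trans hap)
          exact mem_subtree_of_parent_of_ne h.child ih hwv.symm
        · exact mem_subtree_trans hvu
            (mem_subtree_trans (mem_subtree_of_parent (h.parent_upper ▸ hap)) ih)
        · obtain rfl : u = p := Option.some_injective _ (hp'.symm.trans hap)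
          exact mem_subtree_trans (mem_subtree_of_parent hp) (mem_subtree_trans hvu ih)
        · obtain rfl : v = p := Option.some_injective _ (hp'.symm.trans hap)
          exact mem_subtree_trans (mem_subtree_of_parent hp) ih
        · exact mem_subtree_trans (mem_subtree_of_parent (hp ▸ hap)) ih
    · intro ha
      induction ha using Relation.ReflTransGen.head_induction_on with
      | refl => exact T'.mem_subtree_self w
      | @head a p hap _ ih =>
        rcases hpar a with rfl | rfl | ⟨hp, hp' | hp'⟩ | hp
        · exact mem_subtree_trans huv (mem_subtree_trans
            (mem_subtree_of_parent (h.parent_upper.trans hap)) ih)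
        · obtain rfl : u = p := Option.some_injective _ (h.child.symm.trans hap)
          exact mem_subtree_of_parent_of_ne h.parent_lower ih hwu.symm
        · obtain rfl : v = p := Option.some_injective _ (hp.symm.trans hap)
          exact mem_subtree_trans (mem_subtree_of_parent hp') (mem_subtree_trans huv ih)
        · obtain rfl : v = p := Option.some_injective _ (hp.symm.trans hap)
          exact mem_subtree_trans (mem_subtree_of_parent hp') ih
        · exact mem_subtree_trans (mem_subtree_of_parent (hp.trans hap)) ih

theorem isRotation_of_subtree [Finite V] (hG : G.Connected) (hT : T.IsSearchTree G)
    (hT' : T'.IsSearchTree G) {u v : V} (huv : u ≠ v) (h₁ : T'.subtree v = T.subtree u)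
    (h₂ : ∀ w, w ≠ u → w ≠ v → T'.subtree w = T.subtree w) : T.IsRotation G u v T' := by
  rw [isSearchTree_iff hG] at hT hT'
  obtain ⟨hadj, hconn⟩ := hT
  obtain ⟨hadj', hconn'⟩ := hT'
  have hvu : v ∈ T.subtree u := h₁ ▸ T'.mem_subtree_self v
  have huv' : u ∈ T'.subtree v := h₁ ▸ T.mem_subtree_self u
  have child : T.parent v = some u := by
    refine parent_eq_some_iff.2 ⟨hvu, huv.symm, fun z hz hvz => ?_⟩
    rcases mem_subtree_total hvu hz with h | h
    · exact h
    by_cases hzu : z = u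
    · exact hzu ▸ T.mem_subtree_self u
    rw [← h₁] at h
    rw [← h₂ z hzu hvz.symm] at hz
    exact (hvz (mem_subtree_antisymm hz h)).elim
  have lower : T'.parent u = some v := by
    refine parent_eq_some_iff.2 ⟨huv', huv, fun z hz huz => ?_⟩
    rcases mem_subtree_total huv' hz with h | h
    · exact h
    by_cases hzv : z = v
    · exact hzv ▸ T'.mem_subtree_self v
    rw [h₁] at h
    rw [h₂ z huz.symm hzv] at hz
    exact (huz (mem_subtree_antisymm hz h)).elim
  have hu_lower : T'.subtree u ⊆ T.subtree u := fun a ha => by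
    rw [← h₁]; exact mem_subtree_trans ha huv'
  have ne_child : ∀ w, T.parent w = some v → w ≠ u := by
    rintro w hw rfl
    exact not_mem_subtree_of_parent child (mem_subtree_of_parent hw)
  have below_u : ∀ w, w ≠ u → w ≠ v → (∃ s ∈ T.subtree w, G.Adj u s) → w ∈ T.subtree u →
      w ∈ T'.subtree u := by
    rintro w hwu hwv ⟨s, hs, hus⟩ hw
    have hs' : s ∈ T'.subtree w := by rwa [h₂ w hwu hwv]
    have huw : u ∉ T'.subtree w := by
      rw [h₂ w hwu hwv]
      exact fun h => hwu (mem_subtree_antisymm hw h)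
    rcases hadj' u s hus with h | h
    · exact (huw (mem_subtree_trans h hs')).elim
    · exact (mem_subtree_total hs' h).resolve_right huw
  refine ⟨child, lower, ?_, ?_, ?_, ?_⟩
  · cases hu : T.parent u with
    | none =>
      rw [parent_eq_none_iff_subtree] at hu ⊢
      exact fun b => h₁ ▸ hu b
    | some q =>
      have hq := parent_eq_some_iff.1 hu
      have hqv : q ≠ v := by
        rintro rfl
        exact not_mem_subtree_of_parent hu hvu
      refine parent_eq_some_iff.2 ⟨?_, hqv.symm, fun z hz hvz => ?_⟩
      · rw [h₂ q hq.2.1.symm hqv]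
        exact mem_subtree_trans hvu hq.1
      · have hzu : z ≠ u := by
          rintro rfl
          exact not_mem_subtree_of_parent lower hz
        rw [h₂ z hzu hvz.symm] at hz ⊢
        exact hq.2.2 z (mem_subtree_of_parent_of_ne child hz hvz) hzu.symm
  · intro w hw hs
    have hwu := ne_child w hw
    have hwv := parent_ne hw
    refine parent_eq_some_iff.2 ⟨below_u w hwu hwv hs
      (mem_subtree_trans (mem_subtree_of_parent hw) hvu), hwu, fun z hz hwz => ?_⟩
    by_cases hzu : z = u
    · exact hzu ▸ T'.mem_subtree_self u
    by_cases hzv : z = v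
    · exact hzv ▸ huv'
    rw [h₂ z hzu hzv] at hz ⊢
    exact mem_subtree_of_parent_of_ne child (mem_subtree_of_parent_of_ne hw hz hwz) (Ne.symm hzv)
  · intro w hw hs
    have hwu := ne_child w hw
    have hwv := parent_ne hw
    have hwu' : w ∉ T'.subtree u := by
      intro h
      have huw : u ∉ T.subtree w := fun h' => not_mem_subtree_of_parent child
        (mem_subtree_trans h' (mem_subtree_of_parent hw))
      obtain ⟨s, t, -, ht, hsw, htw, hst⟩ := (hconn' u).exists_adj_boundary h
        (T'.mem_subtree_self u) (T.mem_subtree_self w) huw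
      have hwt : w ∈ T.subtree t := by
        rcases hadj s t hst with h' | h'
        · exact (mem_subtree_total hsw h').resolve_right htw
        · exact (htw (mem_subtree_trans h' hsw)).elim
      have hvt : v ∈ T.subtree t := mem_subtree_of_parent_of_ne hw hwt
        (by rintro rfl; exact htw (T.mem_subtree_self w))
      have htv : v ≠ t := by
        rintro rfl
        exact not_mem_subtree_of_parent lower ht
      have hut := mem_subtree_of_parent_of_ne child hvt htv
      obtain rfl := mem_subtree_antisymm hut (hu_lower ht)
      exact hs ⟨s, hsw, hst.symm⟩
    refine parent_eq_some_iff.2 ⟨?_, hwv, fun z hz hwz => ?_⟩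
    · rw [h₁]
      exact mem_subtree_trans (mem_subtree_of_parent hw) hvu
    by_cases hzu : z = u
    · exact (hwu' (hzu ▸ hz)).elim
    by_cases hzv : z = v
    · exact hzv ▸ T'.mem_subtree_self v
    rw [h₂ z hzu hzv] at hz ⊢
    exact mem_subtree_of_parent_of_ne hw hz hwz
  · intro w hwu hwv hw
    cases hp : T.parent w with
    | none =>
      rw [parent_eq_none_iff_subtree] at hp ⊢
      rwa [h₂ w hwu hwv]
    | some p =>
      have hpv : p ≠ v := by
        rintro rfl
        exact hw hp
      have hwp := parent_eq_some_iff.1 hp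
      by_cases hpu : p = u
      · subst hpu
        have hpw := not_mem_subtree_of_parent hp
        obtain ⟨s, t, -, ht, hsw, htw, hst⟩ := (hconn p).exists_adj_boundary hwp.1
          (T.mem_subtree_self p) (T.mem_subtree_self w) hpw
        have hwt : w ∈ T.subtree t := by
          rcases hadj s t hst with h' | h'
          · exact (mem_subtree_total hsw h').resolve_right htw
          · exact (htw (mem_subtree_trans h' hsw)).elim
        have hpt := hwp.2.2 t hwt (by rintro rfl; exact htw (T.mem_subtree_self w))
        obtain rfl := mem_subtree_antisymm hpt ht
        refine parent_eq_some_iff.2 ⟨below_u w hwu hwv ⟨s, hsw, hst.symm⟩ hwp.1, hwu,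
          fun z hz hwz => ?_⟩
        by_cases hzu : z = p
        · exact hzu ▸ T'.mem_subtree_self p
        by_cases hzv : z = v
        · exact hzv ▸ huv'
        rw [h₂ z hzu hzv] at hz ⊢
        exact hwp.2.2 z hz hwz
      · have key : w ∈ T.subtree u → p ∈ T.subtree u := fun h => hwp.2.2 u h hwu
        refine parent_eq_some_iff.2 ⟨?_, hwp.2.1, fun z hz hwz => ?_⟩
        · rw [h₂ p hpu hpv]
          exact hwp.1
        by_cases hzv : z = v
        · subst hzv
          rw [h₁] at hz ⊢
          exact key hz
        by_cases hzu : z = u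
        · subst hzu
          have hpz := key (hu_lower hz)
          have hwp' : w ∈ T'.subtree p := by rw [h₂ p hpu hpv]; exact hwp.1
          rcases mem_subtree_total hz hwp' with h | h
          · rw [h₂ p hpu hpv] at h
            exact (hpu (mem_subtree_antisymm hpz h)).elim
          · exact h
        rw [h₂ z hzu hzv] at hz ⊢
        exact hwp.2.2 z hz hwz

end SearchTree

end RootedTreeOn

namespace RootedTreeOn

variable {V : Type*} {T T' : RootedTreeOn V} {G : SimpleGraph V}

theorem IsRotation.ne {u v : V} (h : T.IsRotation G u v T') : T ≠ T' := by
  rintro rfl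
  exact not_mem_subtree_of_parent h.child (mem_subtree_of_parent h.parent_lower)

theorem IsRotation.ne_vertices {u v : V} (h : T.IsRotation G u v T') : u ≠ v :=
  (parent_ne h.child).symm

theorem IsRotation.reverse [Finite V] (hG : G.Connected) (hT : T.IsSearchTree G)
    (hT' : T'.IsSearchTree G) {u v : V} (h : T.IsRotation G u v T') : T'.IsRotation G v u T :=
  isRotation_of_subtree hG hT' hT h.ne_vertices.symm h.subtree_spec.1.symm
    fun w hwv hwu => (h.subtree_spec.2 w hwu hwv).symm

/-- A ranking of the vertices in which only nonadjacent vertices of rank zero are tied, and in which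
at most one rank lies below a universal vertex, gives a search tree. -/
theorem exists_isSearchTree_of_rank [Finite V] {u : V} (hu : G.IsUniversal u) (r : V → ℕ)
    (hr : ∀ y z, r y = r z → y = z ∨ (r y = 0 ∧ ¬ G.Adj y z)) (hru : r u ≤ 1) :
    ∃ T : RootedTreeOn V, T.IsSearchTree G ∧ ∀ a b, a ∈ T.subtree b ↔ a = b ∨ r a < r b := by
  have hu' : ∀ z, r u = r z → u = z := fun z h => by
    by_contra hne
    exact ((hr u z h).resolve_left hne).2 (hu hne)
  obtain ⟨T, hT⟩ := exists_of_order (fun a b : V => a = b ∨ r a < r b) (fun _ => Or.inl rfl)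
    (by
      rintro a b c (rfl | h) (rfl | h')
      · exact Or.inl rfl
      · exact Or.inr h'
      · exact Or.inr h
      · exact Or.inr (h.trans h'))
    (by
      rintro a b (rfl | h) (h' | h')
      · rfl
      · rfl
      · exact h'.symm
      · omega)
    (by
      rintro a b c (rfl | h) (rfl | h')
      · exact Or.inl (Or.inl rfl)
      · exact Or.inl (Or.inr h')
      · exact Or.inr (Or.inr h)
      · rcases lt_trichotomy (r b) (r c) with h₁ | h₁ | h₁
        · exact Or.inl (Or.inr h₁)
        · rcases hr b c h₁ with h₂ | h₂
          · exact Or.inl (Or.inl h₂)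
          · omega
        · exact Or.inr (Or.inr h₁))
    u (by
      intro a
      rcases lt_trichotomy (r u) (r a) with h₁ | h₁ | h₁
      · exact Or.inl (Or.inr h₁)
      · exact Or.inl (Or.inl (hu' a h₁))
      · exact Or.inr (Or.inr h₁))
  refine ⟨T, (isSearchTree_iff (SimpleGraph.Connected.of_isUniversal hu)).2 ⟨?_, ?_⟩, hT⟩
  · intro a b hab
    rw [hT, hT]
    rcases lt_trichotomy (r a) (r b) with h₁ | h₁ | h₁
    · exact Or.inl (Or.inr h₁)
    · rcases hr a b h₁ with h₂ | h₂
      · exact Or.inl (Or.inl h₂)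
      · exact (h₂.2 hab).elim
    · exact Or.inr (Or.inr h₁)
  · intro z
    by_cases hz : r z = 0
    · refine SimpleGraph.connected_induce_of_forall_adj (T.mem_subtree_self z) fun w hw hne => ?_
      rcases (hT w z).1 hw with h | h
      · exact (hne h.symm).elim
      · omega
    · refine SimpleGraph.connected_induce_of_forall_adj (u := u) ?_ fun w _ hne => hu hne
      rw [hT]
      by_cases h : r u = r z
      · exact Or.inl (hu' z h)
      · exact Or.inr (by omega)

end RootedTreeOn

namespace SimpleGraph

open RootedTreeOn

variable {V : Type*} {G : SimpleGraph V}

theorem rotationGraph_adj_iff [Finite V] (hG : G.Connected)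
    {T T' : {T : RootedTreeOn V // T.IsSearchTree G}} :
    G.rotationGraph.Adj T T' ↔ ∃ u v, T.1.IsRotation G u v T'.1 := by
  constructor
  · rintro ⟨-, h | ⟨u, v, h⟩⟩
    · exact h
    · exact ⟨v, u, h.reverse hG T'.2 T.2⟩
  · rintro ⟨u, v, h⟩
    exact ⟨fun e => h.ne (congrArg Subtype.val e), Or.inl ⟨u, v, h⟩⟩

theorem rotationGraph_adj_of_subtree [Finite V] (hG : G.Connected)
    {T T' : {T : RootedTreeOn V // T.IsSearchTree G}} (u v : V) (huv : u ≠ v)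
    (h₁ : ∀ a, a ∈ T'.1.subtree v ↔ a ∈ T.1.subtree u)
    (h₂ : ∀ w, w ≠ u → w ≠ v → ∀ a, a ∈ T'.1.subtree w ↔ a ∈ T.1.subtree w) :
    G.rotationGraph.Adj T T' :=
  (rotationGraph_adj_iff hG).2 ⟨u, v, isRotation_of_subtree hG T.2 T'.2 huv (Set.ext h₁)
    fun w hu hv => Set.ext (h₂ w hu hv)⟩

set_option linter.unusedSimpArgs false in
/-- The five search trees that have all vertices but `u`, `a`, `b` in the same chain at the top
form a pentagon in the rotation graph. -/
theorem exists_pentagon_rotationGraph [Finite V] {u a b : V} (hu : G.IsUniversal u) (hab : a ≠ b)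
    (hnab : ¬ G.Adj a b) : ∃ T₁ T₂ T₃ T₄ T₅, G.rotationGraph.Adj T₁ T₂ ∧
      G.rotationGraph.Adj T₂ T₃ ∧ G.rotationGraph.Adj T₃ T₄ ∧ G.rotationGraph.Adj T₄ T₅ ∧
      G.rotationGraph.Adj T₅ T₁ := by
  classical
  have hG := Connected.of_isUniversal hu
  have hua : u ≠ a := by
    rintro rfl
    exact hnab (hu hab)
  have hub : u ≠ b := by
    rintro rfl
    exact hnab (hu hab.symm).symm
  obtain ⟨n, ⟨e⟩⟩ := Finite.exists_equiv_fin V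
  let rk : ℕ → ℕ → ℕ → V → ℕ := fun i j k w =>
    if w = u then i else if w = a then j else if w = b then k else e w + 3
  have rku : ∀ i j k, rk i j k u = i := fun i j k => by simp [rk]
  have rka : ∀ i j k, rk i j k a = j := fun i j k => by simp [rk, hua.symm]
  have rkb : ∀ i j k, rk i j k b = k := fun i j k => by simp [rk, hub.symm, hab.symm]
  have rko : ∀ i j k w, w ≠ u → w ≠ a → w ≠ b → rk i j k w = e w + 3 := fun i j k w h₁ h₂ h₃ => by
    simp [rk, h₁, h₂, h₃]
  have cases4 : ∀ w, w = u ∨ w = a ∨ w = b ∨ (w ≠ u ∧ w ≠ a ∧ w ≠ b) := fun w => by tauto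
  have tree : ∀ i j k, i ≤ 1 → j ≤ 2 → k ≤ 2 → i ≠ j → i ≠ k → (j = k → j = 0) →
      ∃ T : {T : RootedTreeOn V // T.IsSearchTree G},
        ∀ x y, x ∈ T.1.subtree y ↔ x = y ∨ rk i j k x < rk i j k y := by
    intro i j k hi hj hk hij hik hjk
    obtain ⟨T, hT, hT'⟩ := exists_isSearchTree_of_rank hu (rk i j k) (by
      intro y z hyz
      rcases cases4 y with rfl | rfl | rfl | ⟨h₁, h₂, h₃⟩ <;>
        rcases cases4 z with rfl | rfl | rfl | ⟨h₄, h₅, h₆⟩ <;>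
        simp only [rku, rka, rkb, rko, *, ne_eq, not_false_eq_true] at hyz
      all_goals first
        | exact Or.inl rfl
        | omega
        | exact Or.inr ⟨by rw [rka]; omega, hnab⟩
        | exact Or.inr ⟨by rw [rkb]; omega, fun h => hnab h.symm⟩
        | exact Or.inl (e.injective (Fin.ext (by omega)))) (by rw [rku]; exact hi)
    exact ⟨⟨T, hT⟩, hT'⟩
  obtain ⟨T₁, h₁⟩ := tree 1 0 0 (by simp) (by simp) (by simp) (by simp) (by simp) (by simp)
  obtain ⟨T₂, h₂⟩ := tree 1 2 0 (by simp) (by simp) (by simp) (by simp) (by simp) (by simp)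
  obtain ⟨T₃, h₃⟩ := tree 0 2 1 (by simp) (by simp) (by simp) (by simp) (by simp) (by simp)
  obtain ⟨T₄, h₄⟩ := tree 0 1 2 (by simp) (by simp) (by simp) (by simp) (by simp) (by simp)
  obtain ⟨T₅, h₅⟩ := tree 1 0 2 (by simp) (by simp) (by simp) (by simp) (by simp) (by simp)
  refine ⟨T₁, T₂, T₃, T₄, T₅, rotationGraph_adj_of_subtree hG u a hua ?_ ?_,
    rotationGraph_adj_of_subtree hG u b hub ?_ ?_, rotationGraph_adj_of_subtree hG a b hab ?_ ?_,
    (rotationGraph_adj_of_subtree hG u a hua ?_ ?_).symm,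
    (rotationGraph_adj_of_subtree hG u b hub ?_ ?_).symm⟩
  all_goals first
    | intro w hw hw' x
      simp only [h₁, h₂, h₃, h₄, h₅]
      clear h₁ h₂ h₃ h₄ h₅ tree
      rcases cases4 w with rfl | rfl | rfl | ⟨hu, ha, hb⟩ <;>
        first
        | exact absurd rfl hw
        | exact absurd rfl hw'
        | rcases cases4 x with rfl | rfl | rfl | ⟨hu', ha', hb'⟩ <;>
          simp [rku, rka, rkb, rko, hua.symm, hub.symm, hab.symm, *]
    | intro x
      simp only [h₁, h₂, h₃, h₄, h₅]
      clear h₁ h₂ h₃ h₄ h₅ tree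
      rcases cases4 x with rfl | rfl | rfl | ⟨hu, ha, hb⟩ <;>
        simp [rku, rka, rkb, rko, hua.symm, hub.symm, hab.symm, *]

theorem three_le_of_colorable_rotationGraph [Finite V] {u : V} (hu : G.IsUniversal u) (hG : G ≠ ⊤)
    {n : ℕ} (h : G.rotationGraph.Colorable n) : 3 ≤ n := by
  obtain ⟨a, b, hab, hnab⟩ : ∃ a b, a ≠ b ∧ ¬ G.Adj a b := by
    by_contra! hcon
    exact hG (top_le_iff.1 fun a b => hcon a b)
  obtain ⟨T₁, T₂, T₃, T₄, T₅, h₁, h₂, h₃, h₄, h₅⟩ := exists_pentagon_rotationGraph hu hab hnab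
  obtain ⟨C⟩ := h
  have := Fin.val_ne_of_ne (C.valid h₁)
  have := Fin.val_ne_of_ne (C.valid h₂)
  have := Fin.val_ne_of_ne (C.valid h₃)
  have := Fin.val_ne_of_ne (C.valid h₄)
  have := Fin.val_ne_of_ne (C.valid h₅)
  omega

end SimpleGraph

namespace SimpleGraph

open RootedTreeOn

variable {V : Type*} {G : SimpleGraph V} {K : Set V}

theorem IsUniversal.addVertex {k : V} (hk : G.IsUniversal k) (hkK : k ∈ K) :
    (G.addVertex K).IsUniversal (some k) := by
  rintro (_ | w) hw
  · exact hkK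
  · exact hk fun e => hw (congrArg some e)

theorem exists_isSearchTree_addVertex_top [Finite V] (hG : G.Connected) {k : V}
    (hk : G.IsUniversal k) (hkK : k ∈ K) {T : RootedTreeOn V} (hT : T.IsSearchTree G) :
    ∃ T' : RootedTreeOn (Option V), T'.IsSearchTree (G.addVertex K) ∧
      ∀ a b, a ∈ T'.subtree b ↔ ∀ b' ∈ b, ∃ a' ∈ a, a' ∈ T.subtree b' := by
  obtain ⟨T', hT'⟩ := exists_of_order
    (fun a b : Option V => ∀ b' ∈ b, ∃ a' ∈ a, a' ∈ T.subtree b')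
    (fun a b' hb' => ⟨b', hb', T.mem_subtree_self b'⟩)
    (fun a b c hab hbc c' hc' => by
      obtain ⟨b', hb', h⟩ := hbc c' hc'
      obtain ⟨a', ha', h'⟩ := hab b' hb'
      exact ⟨a', ha', mem_subtree_trans h' h⟩)
    (by
      rintro (_ | a) (_ | b) h h'
      · rfl
      · simp at h
      · simp at h'
      · simp only [Option.mem_some_iff, forall_eq', exists_eq_left'] at h h'
        rw [mem_subtree_antisymm h h'])
    (by
      rintro (_ | a) (_ | b) (_ | c) h h' <;>
        simp only [Option.mem_some_iff, forall_eq', exists_eq_left', Option.not_mem_none,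
          false_and, exists_false, IsEmpty.forall_iff, implies_true, true_or, or_true] at h h' ⊢
      exact mem_subtree_total h h')
    none (fun a => Or.inr (by simp))
  refine ⟨T', (isSearchTree_iff (Connected.of_isUniversal (hk.addVertex hkK))).2 ⟨?_, ?_⟩, hT'⟩
  · rw [isSearchTree_iff hG] at hT
    rintro (_ | a) (_ | b) h
    · simp [hT']
    · exact Or.inr (by simp [hT'])
    · exact Or.inl (by simp [hT'])
    · simpa [hT'] using hT.1 a b h
  · rw [isSearchTree_iff hG] at hT
    rintro (_ | b)
    · exact connected_induce_of_forall_adj (u := some k) (by simp [hT'])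
        fun w _ hw => hk.addVertex hkK hw
    · let f : G.induce (T.subtree b) →g (G.addVertex K).induce (T'.subtree (some b)) :=
        ⟨fun x => ⟨some x.1, by simp [hT']⟩, fun h => h⟩
      refine (hT.2 b).map f ?_
      rintro ⟨_ | y, hy⟩
      · simp [hT'] at hy
      · exact ⟨⟨y, by simpa [hT'] using hy⟩, rfl⟩

theorem chromaticNumber_rotationGraph_le_addVertex [Finite V] (hG : G.Connected) {k : V}
    (hk : G.IsUniversal k) (hkK : k ∈ K) :
    G.rotationGraph.chromaticNumber ≤ (G.addVertex K).rotationGraph.chromaticNumber := by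
  have hex := fun T : {T : RootedTreeOn V // T.IsSearchTree G} =>
    exists_isSearchTree_addVertex_top (K := K) hG hk hkK T.2
  choose f hf hfs using hex
  refine chromaticNumber_mono_of_hom (⟨fun T => ⟨f T, hf T⟩, fun {T T'} h => ?_⟩ :
    G.rotationGraph →g (G.addVertex K).rotationGraph)
  obtain ⟨u, v, h⟩ := (rotationGraph_adj_iff hG).1 h
  refine rotationGraph_adj_of_subtree (Connected.of_isUniversal (hk.addVertex hkK)) (some u)
    (some v) (by simpa using h.ne_vertices) (fun a => ?_) fun w hwu hwv a => ?_
  · simp [hfs, h.subtree_spec.1]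
  · cases w with
    | none => simp [hfs]
    | some w =>
      simp [hfs, h.subtree_spec.2 w (fun e => hwu (congrArg some e))
        (fun e => hwv (congrArg some e))]

theorem IsUniversal.mem_subtree_total [Finite V] {k : V} (hk : G.IsUniversal k) {T : RootedTreeOn V}
    (hT : T.IsSearchTree G) (a : V) : k ∈ T.subtree a ∨ a ∈ T.subtree k := by
  by_cases h : k = a
  · exact Or.inl (h ▸ T.mem_subtree_self k)
  · exact ((isSearchTree_iff (Connected.of_isUniversal hk)).1 hT).1 k a (hk h)

theorem exists_mem_subtree_of_none_mem [Finite V] {k : V} (hk : G.IsUniversal k) (hkK : k ∈ K)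
    {T : RootedTreeOn (Option V)} (hT : T.IsSearchTree (G.addVertex K)) {a b : Option V}
    (h : none ∈ T.subtree b) (hne : a ≠ none) (ha : a ∈ T.subtree b) :
    ∃ l ∈ K, some l ∈ T.subtree b := by
  obtain ⟨s, t, -, ht, hs, -, hst⟩ :=
    (((isSearchTree_iff (Connected.of_isUniversal (hk.addVertex hkK))).1 hT).2
      b).exists_adj_boundary (A := {none}) h ha rfl hne
  obtain rfl : s = none := hs
  cases t with
  | none => exact hst.elim
  | some l => exact ⟨l, hst, ht⟩

theorem exists_isSearchTree_restrict [Finite V] (hG : G.Connected) (hne : K.Nonempty)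
    (hK : ∀ k ∈ K, G.IsUniversal k) {T : RootedTreeOn (Option V)}
    (hT : T.IsSearchTree (G.addVertex K)) :
    ∃ T' : RootedTreeOn V, T'.IsSearchTree G ∧
      ∀ a b, a ∈ T'.subtree b ↔ some a ∈ T.subtree (some b) := by
  obtain ⟨k, hkK⟩ := hne
  have hk := hK k hkK
  obtain ⟨T', hT'⟩ := exists_of_order (fun a b => some a ∈ T.subtree (some b))
    (fun a => T.mem_subtree_self _) (fun a b c => mem_subtree_trans)
    (fun a b h h' => Option.some_injective _ (mem_subtree_antisymm h h'))
    (fun a b c => RootedTreeOn.mem_subtree_total) k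
    (fun a => (hk.addVertex hkK).mem_subtree_total hT (some a))
  refine ⟨T', (isSearchTree_iff hG).2 ⟨fun a b hab => ?_, fun b => ?_⟩, hT'⟩
  · rw [hT', hT']
    exact ((isSearchTree_iff (Connected.of_isUniversal (hk.addVertex hkK))).1 hT).1 _ _ hab
  · by_cases h : ∃ l ∈ K, some l ∈ T.subtree (some b)
    · obtain ⟨l, hl, hlb⟩ := h
      exact connected_induce_of_forall_adj ((hT' l b).2 hlb) fun w _ hw => hK l hl hw
    · have hx : none ∉ T.subtree (some b) := fun hx =>
        h (exists_mem_subtree_of_none_mem hk hkK hT hx (by simp) (T.mem_subtree_self (some b)))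
      have hconn := ((isSearchTree_iff (Connected.of_isUniversal (hk.addVertex hkK))).1 hT).2
        (some b)
      let f : (G.addVertex K).induce (T.subtree (some b)) →g G.induce (T'.subtree b) :=
        ⟨fun x => ⟨x.1.get (Option.isSome_iff_ne_none.2 fun e => hx (e ▸ x.2)), by
          rw [hT', Option.some_get]; exact x.2⟩, by
          rintro ⟨_ | x, hx'⟩ ⟨_ | y, hy'⟩ h
          · exact (hx hx').elim
          · exact (hx hx').elim
          · exact (hx hy').elim
          · exact h⟩
      refine hconn.map f ?_
      rintro ⟨y, hy⟩
      exact ⟨⟨some y, (hT' y b).1 hy⟩, rfl⟩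

/-- In a search tree on `G_K`, the new vertex has at most one child if `K` consists of universal
vertices of `G`: all vertices strictly below it lie below any given child. -/
theorem mem_subtree_child_none_iff [Finite V] (hne : K.Nonempty) (hK : ∀ k ∈ K, G.IsUniversal k)
    {T : RootedTreeOn (Option V)} (hT : T.IsSearchTree (G.addVertex K)) {v : Option V}
    (hv : T.parent v = some none) (a : V) :
    some a ∈ T.subtree v ↔ some a ∈ T.subtree none := by
  refine ⟨fun h => mem_subtree_trans h (mem_subtree_of_parent hv), fun h => ?_⟩
  obtain ⟨k, hkK⟩ := hne
  obtain ⟨l, hl, hlx⟩ := exists_mem_subtree_of_none_mem (hK k hkK) hkK hT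
    (T.mem_subtree_self none) (parent_ne hv) (mem_subtree_of_parent hv)
  have hlU := ((hK l hl).addVertex hl).mem_subtree_total hT
  have hlv : some l ∈ T.subtree v := by
    rcases hlU v with h' | h'
    · exact h'
    · by_cases e : v = some l
      · exact e ▸ T.mem_subtree_self v
      · have := mem_subtree_antisymm hlx (mem_subtree_of_parent_of_ne hv h' e)
        cases this
  rcases hlU (some a) with h' | h'
  · rcases RootedTreeOn.mem_subtree_total hlv h' with h'' | h''
    · by_cases e : v = some a
      · exact e ▸ T.mem_subtree_self v
      · have := mem_subtree_antisymm h (mem_subtree_of_parent_of_ne hv h'' e)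
        cases this
    · exact h''
  · exact mem_subtree_trans h' hlv

open Classical in
/-- The correction of the colour of a search tree on `G_K` that depends on the place of the new
vertex. -/
noncomputable def colorShift (K : Set V) (T : RootedTreeOn (Option V)) : ℕ :=
  if ∃ k ∈ K, some k ∈ T.subtree none then {w | none ∈ T.subtree w}.ncard % 2 + 1 else 0

theorem colorShift_lt_three (K : Set V) (T : RootedTreeOn (Option V)) : colorShift K T < 3 := by
  unfold colorShift
  split_ifs <;> omega

theorem colorShift_eq_of_isRotation [Finite V] (hK : ∀ k ∈ K, G.IsUniversal k)
    {T T' : RootedTreeOn (Option V)} (hT : T.IsSearchTree (G.addVertex K))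
    (hT' : T'.IsSearchTree (G.addVertex K)) {u v : Option V}
    (h : T.IsRotation (G.addVertex K) u v T') (hu : u ≠ none) (hv : v ≠ none) :
    colorShift K T = colorShift K T' := by
  obtain ⟨h₁, h₂⟩ := h.subtree_spec
  have hx := h₂ none hu.symm hv.symm
  unfold colorShift
  rw [hx]
  split_ifs with hk
  · obtain ⟨k, hk, hkx⟩ := hk
    have key : ∀ (S : RootedTreeOn (Option V)), S.IsSearchTree (G.addVertex K) →
        some k ∈ S.subtree none → ∀ p q, S.parent q = some p → p ≠ none → q ≠ none →
        (none ∈ S.subtree q ↔ none ∈ S.subtree p) := by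
      intro S hS hkS p q hqp hp hq
      refine ⟨fun h => mem_subtree_trans h (mem_subtree_of_parent hqp), fun h => ?_⟩
      have hnq : q ∉ S.subtree none := fun h' => hp
        (mem_subtree_antisymm (mem_subtree_of_parent_of_ne hqp h' hq) h)
      rcases ((hK k hk).addVertex hk).mem_subtree_total hS q with h' | h'
      · exact (RootedTreeOn.mem_subtree_total hkS h').resolve_right hnq
      · exact (hnq (mem_subtree_trans h' hkS)).elim
    have e₁ := key T hT hkx u v h.child hu hv
    have e₂ := key T' hT' (hx ▸ hkx) v u h.parent_lower hv hu
    congr 3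
    ext w
    by_cases hwu : w = u
    · subst hwu
      simp only [Set.mem_ofPred_eq]
      rw [e₂, h₁]
    by_cases hwv : w = v
    · subst hwv
      simp only [Set.mem_ofPred_eq]
      rw [e₁, h₁]
    simp only [Set.mem_ofPred_eq, h₂ w hwu hwv]
  · rfl

theorem colorShift_ne_of_isRotation [Finite V] (hne : K.Nonempty) (hK : ∀ k ∈ K, G.IsUniversal k)
    {T T' : RootedTreeOn (Option V)} (hT : T.IsSearchTree (G.addVertex K)) {v : Option V}
    (h : T.IsRotation (G.addVertex K) none v T') : colorShift K T ≠ colorShift K T' := by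
  obtain ⟨h₁, h₂⟩ := h.subtree_spec
  obtain ⟨k, hk⟩ := hne
  have hx := exists_mem_subtree_of_none_mem (hK k hk) hk hT (T.mem_subtree_self none)
    (parent_ne h.child) (mem_subtree_of_parent h.child)
  have hset : {w | none ∈ T'.subtree w} = insert v {w | none ∈ T.subtree w} := by
    ext w
    simp only [Set.mem_insert_iff, Set.mem_ofPred_eq]
    by_cases hwv : w = v
    · subst hwv
      simp [h₁, T.mem_subtree_self]
    by_cases hwx : w = none
    · subst hwx
      simp [mem_subtree_self]
    simp [hwv, h₂ w hwx hwv]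
  have hcard : {w | none ∈ T'.subtree w}.ncard = {w | none ∈ T.subtree w}.ncard + 1 := by
    rw [hset]
    exact Set.ncard_insert_of_notMem (not_mem_subtree_of_parent h.child)
  unfold colorShift
  rw [if_pos hx, hcard]
  split_ifs <;> omega

theorem colorable_rotationGraph_addVertex [Finite V] (hG : G.Connected) (hGtop : G ≠ ⊤)
    (hne : K.Nonempty) (hK : ∀ k ∈ K, G.IsUniversal k) {n : ℕ}
    (h : G.rotationGraph.Colorable n) : (G.addVertex K).rotationGraph.Colorable n := by
  obtain ⟨k, hkK⟩ := id hne
  have hn := three_le_of_colorable_rotationGraph (hK k hkK) hGtop h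
  have : NeZero n := ⟨by omega⟩
  let C : G.rotationGraph.Coloring (ZMod n) := h.toColoring (by rw [ZMod.card])
  have hGK := Connected.of_isUniversal ((hK k hkK).addVertex hkK)
  have hex := fun T : {T : RootedTreeOn (Option V) // T.IsSearchTree (G.addVertex K)} =>
    exists_isSearchTree_restrict hG hne hK T.2
  choose f hf hfs using hex
  let F : {T : RootedTreeOn (Option V) // T.IsSearchTree (G.addVertex K)} →
    {T : RootedTreeOn V // T.IsSearchTree G} := fun T => ⟨f T, hf T⟩
  let c : {T : RootedTreeOn (Option V) // T.IsSearchTree (G.addVertex K)} → ZMod n :=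
    fun T => C (F T) + (colorShift K T.1 : ℕ)
  have hnone : ∀ (T T' : {T : RootedTreeOn (Option V) // T.IsSearchTree (G.addVertex K)})
      (v : Option V), T.1.IsRotation (G.addVertex K) none v T'.1 → c T ≠ c T' := by
    intro T T' v hrot hc
    obtain ⟨h₁, h₂⟩ := hrot.subtree_spec
    have hF : F T = F T' := by
      refine Subtype.ext (eq_of_subtree fun b => Set.ext fun a => ?_)
      change a ∈ (f T).subtree b ↔ a ∈ (f T').subtree b
      rw [hfs, hfs]
      by_cases hb : some b = v
      · subst hb
        rw [h₁]
        exact mem_subtree_child_none_iff hne hK T.2 hrot.child a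
      · rw [h₂ (some b) (by simp) hb]
    have hc' : ((colorShift K T.1 : ℕ) : ZMod n) = (colorShift K T'.1 : ℕ) := by
      simpa [c, hF] using hc
    rw [ZMod.natCast_eq_natCast_iff', Nat.mod_eq_of_lt ((colorShift_lt_three K _).trans_le hn),
      Nat.mod_eq_of_lt ((colorShift_lt_three K _).trans_le hn)] at hc'
    exact colorShift_ne_of_isRotation hne hK T.2 hrot hc'
  have hcol : ∀ {T T'}, (G.addVertex K).rotationGraph.Adj T T' → c T ≠ c T' := by
    intro T T' hadj
    obtain ⟨u, v, hrot⟩ := (rotationGraph_adj_iff hGK).1 hadj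
    cases u with
    | none => exact hnone T T' v hrot
    | some u =>
      cases v with
      | none => exact (hnone T' T _ (hrot.reverse hGK T.2 T'.2)).symm
      | some v =>
        obtain ⟨h₁, h₂⟩ := hrot.subtree_spec
        have hFadj : G.rotationGraph.Adj (F T) (F T') := by
          refine rotationGraph_adj_of_subtree hG u v
            (fun e => hrot.ne_vertices (congrArg some e)) (fun a => ?_) fun w hwu hwv a => ?_
          · change a ∈ (f T').subtree v ↔ a ∈ (f T).subtree u
            rw [hfs, hfs, h₁]
          · change a ∈ (f T').subtree w ↔ a ∈ (f T).subtree w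
            rw [hfs, hfs, h₂ (some w) (by simpa using hwu) (by simpa using hwv)]
        intro hc
        have hs := colorShift_eq_of_isRotation hK T.2 T'.2 hrot (by simp) (by simp)
        exact C.valid hFadj (by simpa [c, hs] using hc)
  have := (Coloring.mk c hcol).colorable
  rwa [ZMod.card] at this

end SimpleGraph

theorem mainTheorem5 {V : Type*} [Finite V] (G : SimpleGraph V) (hconn : G.Connected)
    (hG : G ≠ ⊤) :
    (∀ K : Set V, K.Nonempty → (∀ v ∈ K, G.IsUniversal v) →
      (G.addVertex K).rotationGraph.chromaticNumber = G.rotationGraph.chromaticNumber) ∧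
    (∀ v : V, G.IsUniversal v →
      (G.addVertex {v}).rotationGraph.chromaticNumber = G.rotationGraph.chromaticNumber) := by
  have main : ∀ K : Set V, K.Nonempty → (∀ v ∈ K, G.IsUniversal v) →
      (G.addVertex K).rotationGraph.chromaticNumber = G.rotationGraph.chromaticNumber := by
    intro K hne hK
    obtain ⟨k, hkK⟩ := id hne
    exact le_antisymm
      (SimpleGraph.chromaticNumber_le_of_forall_imp fun n =>
        SimpleGraph.colorable_rotationGraph_addVertex hconn hG hne hK)
      (SimpleGraph.chromaticNumber_rotationGraph_le_addVertex hconn (hK k hkK) hkK)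
  refine ⟨main, fun v hv => main {v} (Set.singleton_nonempty v) ?_⟩
  rintro w rfl
  exact hv
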